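/- For $x\in[0,1)$ let $T(0)=0$, $T(x)=\frac1x \pmod 1$ for $x\in(0,1)$ be the Gauss map and let $a_n(x)=\lfloor 1/T^{n-1}(x)\rfloor$ $(n\ge 1)$ be the partial quotients of the continued fraction expansion of $x$ (with $a_n(x)=0$ if $T^{n-1}(x)=0$, which happens only for rational $x$). Let $m\ge 1$, let $\mathbf t=(t_0,\dots,t_{m-1})$ be positive real numbers, put $t_{\max}=\max_{0\le i\le m-1}t_i$ and $\ell=\#\{i: t_i=t_{\max}\}$, and let $\Psi:\mathbb N=\{1,2,\dots\}\to[1,\infty)$ be any function. Let $$\mathcal E_{\mathbf t}(\Psi)=\Big\{x\in[0,1):\ \prod_{i=0}^{m-1}a_{n+i}(x)^{t_i}\ge\Psi(n)\ \text{for infinitely many } n\in\mathbb N\Big\},$$ and let $\mathcal L$ denote Lebesgue measure. Consider the series $$\sum_{n=1}^\infty\frac{(\log\Psi(n))^{\ell-1}}{\Psi(n)^{1/t_{\max}}},\qquad (\ast)$$ where $(\log\Psi(n))^{0}=1$ for all $n$, even if $\Psi(n)=1$. Then: 1. $\mathcal L(\mathcal E_{\mathbf t}(\Psi))\in\{0,1\}$.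 2. If $(\ast)$ converges, and moreover $\ell=1$ or $\liminf_{n\to\infty}\Psi(n)>1$, then $\mathcal L(\mathcal E_{\mathbf t}(\Psi))=0$. 3. If $(\ast)$ diverges, then $\mathcal L(\mathcal E_{\mathbf t}(\Psi))=1$. -/

import Mathlib

noncomputable section

/-- The Gauss map `T x = 1/x mod 1`; the convention `1 / 0 = 0` gives `T 0 = 0`. -/
def gaussMap (x : ℝ) : ℝ := Int.fract (1 / x)

/-- The partial quotient `aₙ(x) = ⌊1 / Tⁿ⁻¹ x⌋` for `n ≥ 1` (the value at `n = 0` is never used).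
If `x` is rational and its expansion has fewer than `n` terms, the value is `0`. -/
def partialQuotient (n : ℕ) (x : ℝ) : ℕ := ⌊1 / gaussMap^[n - 1] x⌋₊

/-- The set of `x ∈ [0,1)` such that `∏_{i<m} a_{n+i}(x)^{t_i} ≥ Ψ(n)` for infinitely many
positive integers `n`. -/
def weightedLimsupSet {m : ℕ} (t : Fin m → ℝ) (Ψ : ℕ → ℝ) : Set ℝ :=
  {x | x ∈ Set.Ico (0 : ℝ) 1 ∧
    {n : ℕ | 1 ≤ n ∧ Ψ n ≤ ∏ i : Fin m, (partialQuotient (n + i) x : ℝ) ^ t i}.Infinite}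

/-- The largest weight (a maximum, since it is used for `m ≥ 1` only). -/
def maxWeight {m : ℕ} (t : Fin m → ℝ) : ℝ := ⨆ i, t i

/-- The number of indices at which the largest weight is attained. -/
def maxWeightMult {m : ℕ} (t : Fin m → ℝ) : ℕ :=
  (Finset.univ.filter fun i => t i = maxWeight t).card

/-- Convergence of the series `∑_{n ≥ 1} (log Ψ(n))^{ℓ-1} / Ψ(n)^{1/t_max}`, whose terms are
nonnegative when `Ψ ≥ 1`. -/
def WeightedSeriesConverges {m : ℕ} (t : Fin m → ℝ) (Ψ : ℕ → ℝ) : Prop :=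
  Summable fun n : ℕ =>
    Real.log (Ψ (n + 1)) ^ (maxWeightMult t - 1) / Ψ (n + 1) ^ (1 / maxWeight t)

end

/-!
For a uniformly distributed `x`, the conditional law of `Tⁿ x` given the first `n` partial quotients
has density `(1 + s) / (1 + s y) ^ 2` on `[0, 1)`, where `s ∈ [0, 1]` is the ratio of the last two
continuants. These laws `condMeasure s` can be used without continuants, because they reproduce
themselves under the Gauss map: under `condMeasure s` the first partial quotient is `k + 1` with
probability `(1 + s) / ((k + 1 + s) (k + 2 + s))`, and given this, the image of the point has law
`condMeasure (1 / (k + 1 + s))`. This is one change of variables (`condMeasure_eq_tsum`).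

Those weights lie within a factor `2` of `1 / ((k + 1) (k + 2))`, uniformly in `s`. So whatever the
earlier partial quotients are, the probability that the weighted product of the next `m` of them
is at least `v` is within a factor `2 ^ m` of the same probability `digitTail` for independent
digits `aᵢ` with `P(a ≥ b) = 1 / b` (`condMeasure_le_digitTail`, `digitTail_le_condMeasure`). This
has two consequences.

* If `∑ digitTail (Ψ n)` converges, the limsup set is null by the Borel–Cantelli lemma.
* If it diverges, it diverges along some residue class of `n` modulo `m`. The corresponding blocks
  of `m` partial quotients do not overlap, and given the past each of them reaches its threshold
  with conditional probability at least `digitTail (Ψ n) / 2 ^ m`. The probability that none does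
  from some index on is therefore an infinite product equal to `0`
  (`condMeasure_iInter_lowBlocks`), and the limsup set has full measure.

The zero-one law is this dichotomy. It remains to find the order of `digitTail`. After division of
the weights by their maximum, a digit `a` with exponent `α < 1` has finite mean `E[a ^ α]` and does
not change the order of the tail, while each further digit with exponent `1` contributes a harmonic
sum, hence a logarithm. As independent digits are exchangeable, the weights may be sorted, and the
tail at `v` is of the order of `(log v) ^ (ℓ - 1) / v` (`digitTail_bounds`). In the upper bound
`log v` is replaced by `1 + log v`, which is harmless if `ℓ = 1` or `v` stays away from `1`.
-/

open MeasureTheory Set Filter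
open scoped ENNReal Topology

/-! ### Tails of weighted products of independent digits -/

/-- The law of a digit: `P(a = k + 1) = 1 / ((k + 1) (k + 2))`, so that `P(a ≥ b) = 1 / b`. -/
noncomputable def digitWeight (k : ℕ) : ℝ≥0∞ := ENNReal.ofReal (1 / ((k + 1) * (k + 2)))

/-- The probability that `∏ aᵢ ^ αᵢ ≥ v` for independent digits `aᵢ` of law `digitWeight` and the
list `[α₁, α₂, …]` of exponents, computed by summing over the first digit. -/
noncomputable def digitTail : List ℝ → ℝ → ℝ≥0∞
  | [], v => if v ≤ 1 then 1 else 0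
  | α :: l, v => ∑' k : ℕ, digitWeight k * digitTail l (v / ((k : ℝ) + 1) ^ α)

theorem tsum_digitWeight_add (b : ℕ) :
    ∑' k : ℕ, digitWeight (k + b) = ENNReal.ofReal (1 / (b + 1)) := by
  have hnn : ∀ k : ℕ, 0 ≤ (1 : ℝ) / (((k + b : ℕ) + 1) * ((k + b : ℕ) + 2)) := fun k => by
    positivity
  have h : HasSum (fun k : ℕ => (1 : ℝ) / (((k + b : ℕ) + 1) * ((k + b : ℕ) + 2)))
      (1 / (b + 1)) := by
    rw [hasSum_iff_tendsto_nat_of_nonneg hnn]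
    have h1 : ∀ n : ℕ, ∑ k ∈ Finset.range n,
        (1 : ℝ) / (((k + b : ℕ) + 1) * ((k + b : ℕ) + 2)) = 1 / (b + 1) - 1 / (n + b + 1) := by
      intro n
      induction n with
      | zero => simp
      | succ n ih =>
        rw [Finset.sum_range_succ, ih]
        push_cast
        field_simp
        ring
    simp only [h1]
    have h2 : Tendsto (fun n : ℕ => (1 : ℝ) / (n + b + 1)) atTop (𝓝 0) := by
      have := (tendsto_one_div_add_atTop_nhds_zero_nat (𝕜 := ℝ)).comp (tendsto_add_atTop_nat b)
      refine this.congr fun n => ?_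
      simp
    simpa using tendsto_const_nhds.sub h2
  unfold digitWeight
  rw [← ENNReal.ofReal_tsum_of_nonneg hnn h.summable, h.tsum_eq]

theorem tsum_digitWeight : ∑' k : ℕ, digitWeight k = 1 := by
  simpa using tsum_digitWeight_add 0

theorem digitTail_le_one (l : List ℝ) (v : ℝ) : digitTail l v ≤ 1 := by
  induction l generalizing v with
  | nil => rw [digitTail]; split_ifs <;> simp
  | cons α l ih =>
    rw [digitTail, ← tsum_digitWeight]
    exact ENNReal.tsum_le_tsum fun k => mul_le_of_le_one_right' (ih _)

theorem digitTail_antitone (l : List ℝ) : Antitone (digitTail l) := by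
  induction l with
  | nil =>
    intro v w h
    simp only [digitTail]
    split_ifs with h1 h2
    · exact le_rfl
    · exact absurd (h.trans h1) h2
    · exact zero_le
    · exact le_rfl
  | cons α l ih =>
    intro v w h
    simp only [digitTail]
    exact ENNReal.tsum_le_tsum fun k => by gcongr; exact ih (by gcongr)

/-- Independent digits are exchangeable, so the order of the exponents is irrelevant. -/
theorem digitTail_perm {l l' : List ℝ} (h : l.Perm l') : digitTail l = digitTail l' := by
  induction h with
  | nil => rfl
  | cons α _ ih => funext v; simp only [digitTail, ih]
  | swap α β l =>
    funext v
    simp only [digitTail, ← ENNReal.tsum_mul_left]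
    rw [ENNReal.tsum_comm]
    refine tsum_congr fun j => tsum_congr fun k => ?_
    rw [div_right_comm, mul_left_comm]
  | trans _ _ ih1 ih2 => exact ih1.trans ih2

/-- Dividing all exponents by `T` amounts to taking `T`-th roots of the products. -/
theorem digitTail_map_div {T : ℝ} (hT : 0 < T) (l : List ℝ) {v : ℝ} (hv : 0 < v) :
    digitTail (l.map (· / T)) (v ^ (1 / T)) = digitTail l v := by
  induction l generalizing v with
  | nil =>
    simp only [List.map_nil, digitTail]
    congr 1
    exact propext (Real.rpow_le_one_iff_of_pos hv |>.trans
      ⟨fun h => h.elim (fun h => absurd h.2 (by simp [hT])) fun h => h.1,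
        fun h => Or.inr ⟨h, by positivity⟩⟩)
  | cons α l ih =>
    simp only [List.map_cons, digitTail]
    refine tsum_congr fun k => ?_
    rw [← ih (by positivity : 0 < v / ((k : ℝ) + 1) ^ α), Real.div_rpow hv.le (by positivity),
      ← Real.rpow_mul (by positivity), mul_one_div]

theorem tsum_digitWeight_ite_le {v : ℝ} (hv : 0 < v) :
    ∑' k : ℕ, (if v ≤ k + 1 then digitWeight k else 0) ≤ ENNReal.ofReal (1 / v) := by
  obtain ⟨b, hb⟩ : ∃ b : ℕ, ⌈v⌉₊ = b + 1 := ⟨⌈v⌉₊ - 1, by have := Nat.ceil_pos.2 hv; omega⟩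
  have hvb : v ≤ b + 1 := by
    have := Nat.le_ceil v
    rw [hb] at this
    exact_mod_cast this
  have h0 : ∑' k : ℕ, (if v ≤ k + 1 then digitWeight k else 0) = ∑' k : ℕ, digitWeight (k + b) := by
    rw [← ENNReal.summable.sum_add_tsum_nat_add' (k := b), Finset.sum_eq_zero, zero_add]
    · refine tsum_congr fun k => if_pos ?_
      push_cast
      linarith [(Nat.cast_nonneg k : (0 : ℝ) ≤ k)]
    · intro k hk
      rw [Finset.mem_range] at hk
      refine if_neg fun h => ?_
      have : ⌈v⌉₊ ≤ k + 1 := Nat.ceil_le.2 (by exact_mod_cast h)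
      omega
  rw [h0, tsum_digitWeight_add]
  refine ENNReal.ofReal_le_ofReal (one_div_le_one_div_of_le hv hvb)

theorem le_tsum_digitWeight_ite {v : ℝ} (hv : 1 ≤ v) :
    ENNReal.ofReal (1 / (2 * v)) ≤ ∑' k : ℕ, (if v ≤ k + 1 then digitWeight k else 0) := by
  rw [← ENNReal.summable.sum_add_tsum_nat_add' (k := ⌊v⌋₊)]
  refine le_trans ?_ le_add_self
  have : ∀ k : ℕ, (if v ≤ (k + ⌊v⌋₊ : ℕ) + 1 then digitWeight (k + ⌊v⌋₊) else 0)
      = digitWeight (k + ⌊v⌋₊) := by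
    intro k
    refine if_pos ?_
    push_cast
    linarith [(Nat.cast_nonneg k : (0 : ℝ) ≤ k), Nat.lt_floor_add_one v]
  simp only [this]
  rw [tsum_digitWeight_add]
  refine ENNReal.ofReal_le_ofReal (one_div_le_one_div_of_le (by positivity) ?_)
  linarith [Nat.floor_le (zero_le_one.trans hv)]

theorem digitTail_singleton_one (v : ℝ) :
    digitTail [1] v = ∑' k : ℕ, (if v ≤ k + 1 then digitWeight k else 0) := by
  simp only [digitTail, Real.rpow_one]
  refine tsum_congr fun k => ?_
  have : v / ((k : ℝ) + 1) ≤ 1 ↔ v ≤ k + 1 := div_le_one (by positivity)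
  simp [this]

theorem tsum_ite_one_div_eq_harmonic {v : ℝ} (hv : 0 ≤ v) :
    ∑' k : ℕ, (if (k : ℝ) + 1 ≤ v then ENNReal.ofReal (1 / (k + 1)) else 0)
      = ENNReal.ofReal (harmonic ⌊v⌋₊) := by
  have hk : ∀ k : ℕ, ((k : ℝ) + 1 ≤ v ↔ k ∈ Finset.range ⌊v⌋₊) := fun k => by
    rw [Finset.mem_range, ← Nat.add_one_le_iff, Nat.le_floor_iff hv]
    push_cast
    rfl
  simp only [hk]
  rw [tsum_eq_sum (s := Finset.range ⌊v⌋₊) (fun k hk => if_neg hk),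
    Finset.sum_congr rfl (fun k hk => if_pos hk),
    ← ENNReal.ofReal_sum_of_nonneg (fun k _ => by positivity)]
  simp [harmonic]

/-- The order of magnitude of the tail of `∏ aᵢ` for `e + 1` independent digits. The positive part
of the logarithm makes the upper bound meaningful for all `v > 0`. -/
noncomputable def tailOrder (e : ℕ) (v : ℝ) : ℝ := (1 + Real.posLog v) ^ e / v

/-- Adding one more digit of exponent `1` costs one more logarithm: this is a harmonic sum. -/
theorem digitTail_replicate_one_le (e : ℕ) : ∃ C : ℝ, 0 ≤ C ∧ ∀ v : ℝ, 0 < v →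
    digitTail (List.replicate (e + 1) 1) v ≤ ENNReal.ofReal (C * tailOrder e v) := by
  induction e with
  | zero =>
    refine ⟨1, zero_le_one, fun v hv => ?_⟩
    simp only [zero_add, List.replicate_one, tailOrder, pow_zero, one_mul]
    rw [digitTail_singleton_one]
    exact tsum_digitWeight_ite_le hv
  | succ e ih =>
    obtain ⟨C, hC, h⟩ := ih
    refine ⟨C + 1, by positivity, fun v hv => ?_⟩
    have hL : 0 ≤ Real.posLog v := Real.posLog_nonneg
    rw [List.replicate_succ, digitTail]
    have hterm : ∀ k : ℕ, digitWeight k *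
          digitTail (List.replicate (e + 1) 1) (v / ((k : ℝ) + 1) ^ (1 : ℝ))
        ≤ (if v ≤ k + 1 then digitWeight k else 0) +
          (if (k : ℝ) + 1 ≤ v then ENNReal.ofReal (1 / (k + 1)) else 0) *
            ENNReal.ofReal (C * tailOrder e v) := by
      intro k
      have hk : (0 : ℝ) < k + 1 := by positivity
      by_cases hkv : v ≤ k + 1
      · rw [if_pos hkv]
        exact (mul_le_of_le_one_right' (digitTail_le_one _ _)).trans le_self_add
      · have hkv' : (k : ℝ) + 1 ≤ v := (not_le.1 hkv).le
        rw [if_neg hkv, zero_add, if_pos hkv', Real.rpow_one]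
        refine (mul_le_mul_right (h _ (by positivity)) _).trans ?_
        rw [digitWeight, ← ENNReal.ofReal_mul (by positivity),
          ← ENNReal.ofReal_mul (by positivity)]
        refine ENNReal.ofReal_le_ofReal ?_
        have h1 : Real.posLog (v / (k + 1)) ≤ Real.posLog v :=
          Real.posLog_le_posLog (by positivity) (div_le_self hv.le
            (by linarith [(Nat.cast_nonneg k : (0 : ℝ) ≤ k)]))
        have h2 : tailOrder e (v / (k + 1)) ≤ (k + 1) * tailOrder e v := by
          unfold tailOrder
          rw [div_div_eq_mul_div, mul_comm, mul_div_assoc]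
          have : 0 ≤ Real.posLog (v / (k + 1)) := Real.posLog_nonneg
          gcongr
        have h3 : 0 ≤ tailOrder e (v / (k + 1)) := by
          have : 0 ≤ Real.posLog (v / (k + 1)) := Real.posLog_nonneg
          unfold tailOrder
          positivity
        calc 1 / (((k : ℝ) + 1) * (k + 2)) * (C * tailOrder e (v / (k + 1)))
            ≤ 1 / (((k : ℝ) + 1) * (k + 1)) * (C * ((k + 1) * tailOrder e v)) := by
              gcongr
              exact one_le_two
          _ = 1 / (k + 1) * (C * tailOrder e v) := by field_simp
    refine (ENNReal.tsum_le_tsum hterm).trans ?_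
    rw [ENNReal.tsum_add, ENNReal.tsum_mul_right, tsum_ite_one_div_eq_harmonic hv.le]
    have hharm : (harmonic ⌊v⌋₊ : ℝ) ≤ 1 + Real.posLog v := by
      rcases le_total 1 v with h1 | h1
      · exact (harmonic_floor_le_one_add_log v h1).trans (by gcongr; exact le_max_right _ _)
      · rcases h1.lt_or_eq with h1 | h1
        · rw [Nat.floor_eq_zero.2 h1]; simp; positivity
        · simp [h1]
    have h3 : 0 ≤ tailOrder e v := by unfold tailOrder; positivity
    refine (add_le_add (tsum_digitWeight_ite_le hv)
      (mul_le_mul_left (ENNReal.ofReal_le_ofReal hharm) _)).trans ?_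
    rw [← ENNReal.ofReal_mul (by positivity), ← ENNReal.ofReal_add (by positivity) (by positivity)]
    refine ENNReal.ofReal_le_ofReal ?_
    have h4 : 1 / v ≤ tailOrder (e + 1) v := by
      unfold tailOrder
      gcongr
      exact one_le_pow₀ (by linarith)
    have h5 : (1 + Real.posLog v) * (C * tailOrder e v) = C * tailOrder (e + 1) v := by
      unfold tailOrder
      ring
    rw [h5]
    linarith

/-- A digit of exponent `α < 1` does not change the order of the tail, since `E[a ^ α]` is
finite. -/
theorem digitTail_cons_le {α : ℝ} (hα0 : 0 ≤ α) (hα : α < 1) {l : List ℝ} {e : ℕ}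
    (hl : ∃ C : ℝ, 0 ≤ C ∧ ∀ v : ℝ, 0 < v → digitTail l v ≤ ENNReal.ofReal (C * tailOrder e v)) :
    ∃ C : ℝ, 0 ≤ C ∧ ∀ v : ℝ, 0 < v →
      digitTail (α :: l) v ≤ ENNReal.ofReal (C * tailOrder e v) := by
  obtain ⟨C, hC, h⟩ := hl
  have hsum : Summable fun k : ℕ => ((k : ℝ) + 1) ^ (α - 2) := by
    have := (summable_nat_add_iff 1).2 (Real.summable_nat_rpow.2 (by linarith : α - 2 < -1))
    simpa using this
  have hnn : ∀ k : ℕ, 0 ≤ ((k : ℝ) + 1) ^ (α - 2) := fun k => by positivity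
  refine ⟨C * ∑' k : ℕ, ((k : ℝ) + 1) ^ (α - 2), mul_nonneg hC (tsum_nonneg hnn), fun v hv => ?_⟩
  have h3 : 0 ≤ tailOrder e v := by
    have : 0 ≤ Real.posLog v := Real.posLog_nonneg
    unfold tailOrder; positivity
  rw [digitTail, mul_right_comm, mul_comm, ENNReal.ofReal_mul (tsum_nonneg hnn),
    ENNReal.ofReal_tsum_of_nonneg hnn hsum, ← ENNReal.tsum_mul_right]
  refine ENNReal.tsum_le_tsum fun k => ?_
  have hk : (1 : ℝ) ≤ k + 1 := by linarith [(Nat.cast_nonneg k : (0 : ℝ) ≤ k)]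
  have hk0 : (0 : ℝ) < k + 1 := by positivity
  refine (mul_le_mul_right (h _ (by positivity)) _).trans ?_
  rw [digitWeight, ← ENNReal.ofReal_mul (by positivity), ← ENNReal.ofReal_mul (by positivity)]
  refine ENNReal.ofReal_le_ofReal ?_
  have h2 : tailOrder e (v / ((k : ℝ) + 1) ^ α) ≤ ((k : ℝ) + 1) ^ α * tailOrder e v := by
    have h1 : Real.posLog (v / ((k : ℝ) + 1) ^ α) ≤ Real.posLog v :=
      Real.posLog_le_posLog (by positivity) (div_le_self hv.le (Real.one_le_rpow hk hα0))
    unfold tailOrder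
    rw [div_div_eq_mul_div, mul_comm, mul_div_assoc]
    have : 0 ≤ Real.posLog (v / ((k : ℝ) + 1) ^ α) := Real.posLog_nonneg
    gcongr
  have h4 : 0 ≤ tailOrder e (v / ((k : ℝ) + 1) ^ α) := by
    have : 0 ≤ Real.posLog (v / ((k : ℝ) + 1) ^ α) := Real.posLog_nonneg
    unfold tailOrder
    positivity
  calc 1 / (((k : ℝ) + 1) * (k + 2)) * (C * tailOrder e (v / ((k : ℝ) + 1) ^ α))
      ≤ 1 / (((k : ℝ) + 1) ^ 2) * (C * (((k : ℝ) + 1) ^ α * tailOrder e v)) := by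
        gcongr
        nlinarith
    _ = ((k : ℝ) + 1) ^ (α - 2) * (C * tailOrder e v) := by
        rw [Real.rpow_sub hk0, Real.rpow_two]
        ring

theorem digitTail_append_le {l₁ l₂ : List ℝ} (h1 : ∀ α ∈ l₁, 0 ≤ α ∧ α < 1) {e : ℕ}
    (h2 : ∃ C : ℝ, 0 ≤ C ∧ ∀ v : ℝ, 0 < v → digitTail l₂ v ≤ ENNReal.ofReal (C * tailOrder e v)) :
    ∃ C : ℝ, 0 ≤ C ∧ ∀ v : ℝ, 0 < v →
      digitTail (l₁ ++ l₂) v ≤ ENNReal.ofReal (C * tailOrder e v) := by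
  induction l₁ with
  | nil => exact h2
  | cons α l ih =>
    rw [List.forall_mem_cons] at h1
    exact digitTail_cons_le h1.1.1 h1.1.2 (ih h1.2)

/-- The lower bound matching `digitTail_replicate_one_le`; it needs `v ≥ 1` because the logarithm
is not truncated. -/
theorem le_digitTail_replicate_one (e : ℕ) : ∃ c : ℝ, 0 < c ∧ ∀ v : ℝ, 1 ≤ v →
    ENNReal.ofReal (c * (Real.log v ^ e / v)) ≤ digitTail (List.replicate (e + 1) 1) v := by
  induction e with
  | zero =>
    refine ⟨1 / 2, by norm_num, fun v hv => ?_⟩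
    simp only [zero_add, List.replicate_one, pow_zero]
    rw [digitTail_singleton_one]
    refine le_trans (le_of_eq ?_) (le_tsum_digitWeight_ite hv)
    congr 1
    field_simp
  | succ e ih =>
    obtain ⟨c, hc, h⟩ := ih
    refine ⟨c / 2 / 2 ^ (e + 1), by positivity, fun v hv => ?_⟩
    have hv0 : 0 < v := by linarith
    have hlog : 0 ≤ Real.log v := Real.log_nonneg hv
    rw [List.replicate_succ, digitTail]
    set w := c / 2 * ((Real.log v / 2) ^ e / v) with hw
    have hw0 : 0 ≤ w := by positivity
    -- Only the first digits up to `√v` are used: for those the remaining quotient is at least `√v`.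
    have hterm : ∀ k : ℕ, (if (k : ℝ) + 1 ≤ √v then ENNReal.ofReal (1 / (k + 1)) else 0) *
          ENNReal.ofReal w
        ≤ digitWeight k * digitTail (List.replicate (e + 1) 1) (v / ((k : ℝ) + 1) ^ (1 : ℝ)) := by
      intro k
      have hk : (0 : ℝ) < k + 1 := by positivity
      by_cases hkv : (k : ℝ) + 1 ≤ √v
      · have hsq : √v ≤ v / (k + 1) := by
          rw [le_div_iff₀ hk]
          calc √v * (k + 1) ≤ √v * √v := by gcongr
            _ = v := Real.mul_self_sqrt hv0.le
        have h1v : 1 ≤ v / (k + 1) := (Real.one_le_sqrt.2 hv).trans hsq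
        have hl : Real.log v / 2 ≤ Real.log (v / (k + 1)) := by
          rw [← Real.log_sqrt hv0.le]
          exact Real.log_le_log (by positivity) hsq
        rw [if_pos hkv, Real.rpow_one]
        refine le_trans ?_ (mul_le_mul_right (h _ h1v) _)
        rw [digitWeight, ← ENNReal.ofReal_mul (by positivity),
          ← ENNReal.ofReal_mul (by positivity)]
        refine ENNReal.ofReal_le_ofReal ?_
        calc 1 / ((k : ℝ) + 1) * w
            = 1 / (((k : ℝ) + 1) * (2 * (k + 1))) *
                (c * ((Real.log v / 2) ^ e / (v / (k + 1)))) := by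
              rw [hw]; field_simp
          _ ≤ _ := by
              gcongr
              linarith [(Nat.cast_nonneg k : (0 : ℝ) ≤ k)]
      · rw [if_neg hkv, zero_mul]
        exact zero_le
    refine le_trans ?_ (ENNReal.tsum_le_tsum hterm)
    rw [ENNReal.tsum_mul_right, tsum_ite_one_div_eq_harmonic (Real.sqrt_nonneg v)]
    have hharm : Real.log v / 2 ≤ harmonic ⌊√v⌋₊ := by
      rw [← Real.log_sqrt hv0.le]
      exact log_le_harmonic_floor _ (Real.sqrt_nonneg v)
    rw [← ENNReal.ofReal_mul (by linarith)]
    refine ENNReal.ofReal_le_ofReal (le_trans (le_of_eq ?_) (mul_le_mul_of_nonneg_right hharm hw0))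
    rw [hw, div_pow, pow_succ 2 e]
    field_simp
    ring

/-- Digits with a nonnegative exponent contribute factors that are at least `1`. -/
theorem digitTail_le_append {l₁ : List ℝ} (l₂ : List ℝ) (h : ∀ α ∈ l₁, 0 ≤ α) {v : ℝ}
    (hv : 0 ≤ v) : digitTail l₂ v ≤ digitTail (l₁ ++ l₂) v := by
  induction l₁ with
  | nil => exact le_rfl
  | cons α l ih =>
    rw [List.forall_mem_cons] at h
    rw [List.cons_append, digitTail]
    calc digitTail l₂ v ≤ digitTail (l ++ l₂) v := ih h.2
      _ = ∑' k : ℕ, digitWeight k * digitTail (l ++ l₂) v := by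
        rw [ENNReal.tsum_mul_right, tsum_digitWeight, one_mul]
      _ ≤ _ := by
        refine ENNReal.tsum_le_tsum fun k => mul_le_mul_right (digitTail_antitone _ ?_) _
        exact div_le_self hv (Real.one_le_rpow
          (by linarith [(Nat.cast_nonneg k : (0 : ℝ) ≤ k)]) h.1)

/-- If the largest exponent is `1` and it occurs `e + 1` times, the tail is of the order of
`(log v) ^ e / v`. -/
theorem digitTail_bounds {l : List ℝ} (h : ∀ α ∈ l, 0 ≤ α ∧ α ≤ 1) {e : ℕ}
    (he : l.count 1 = e + 1) :
    (∃ C : ℝ, 0 ≤ C ∧ ∀ v : ℝ, 0 < v → digitTail l v ≤ ENNReal.ofReal (C * tailOrder e v)) ∧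
    ∃ c : ℝ, 0 < c ∧ ∀ v : ℝ, 1 ≤ v → ENNReal.ofReal (c * (Real.log v ^ e / v)) ≤ digitTail l v := by
  have hperm : l.Perm (l.filter (fun α => !(α == 1)) ++ List.replicate (e + 1) 1) := by
    rw [← he, ← List.filter_beq]
    exact ((List.perm_append_comm).trans (List.filter_append_perm (· == 1) l)).symm
  have hmem : ∀ α ∈ l.filter (fun α => !(α == 1)), 0 ≤ α ∧ α < 1 := by
    intro α hα
    rw [List.mem_filter] at hα
    exact ⟨(h α hα.1).1, lt_of_le_of_ne (h α hα.1).2 (by simpa using hα.2)⟩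
  rw [digitTail_perm hperm]
  refine ⟨digitTail_append_le hmem (digitTail_replicate_one_le e), ?_⟩
  obtain ⟨c, hc, hlow⟩ := le_digitTail_replicate_one e
  exact ⟨c, hc, fun v hv => (hlow v hv).trans
    (digitTail_le_append _ (fun α hα => (hmem α hα).1) (by linarith))⟩

/-! ### Conditional laws of the Gauss map -/

/-- The conditional law of `Tⁿ x` given the first `n` partial quotients of a uniformly distributed
`x`, where `s` is the ratio of the last two continuants; `s = 0` is Lebesgue measure on
`[0, 1)`. -/
noncomputable def condMeasure (s : ℝ) : Measure ℝ :=
  (volume.restrict (Ico 0 1)).withDensity fun x => ENNReal.ofReal ((1 + s) / (1 + s * x) ^ 2)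

/-- The probability under `condMeasure s` that the first partial quotient is `k + 1`. -/
noncomputable def condWeight (s : ℝ) (k : ℕ) : ℝ≥0∞ :=
  ENNReal.ofReal ((1 + s) / ((k + 1 + s) * (k + 2 + s)))

/-- The inverse branch of the Gauss map onto the points with first partial quotient `k + 1`. -/
noncomputable def gaussBranch (k : ℕ) (y : ℝ) : ℝ := 1 / (k + 1 + y)

theorem floor_one_div_gaussBranch (k : ℕ) {y : ℝ} (hy : y ∈ Ico (0 : ℝ) 1) :
    ⌊1 / gaussBranch k y⌋₊ = k + 1 := by
  have hk : (0 : ℝ) ≤ k := Nat.cast_nonneg k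
  rw [gaussBranch, one_div_one_div, Nat.floor_eq_iff (by linarith [hy.1])]
  push_cast
  constructor <;> linarith [hy.1, hy.2]

theorem gaussMap_gaussBranch (k : ℕ) {y : ℝ} (hy : y ∈ Ico (0 : ℝ) 1) :
    gaussMap (gaussBranch k y) = y := by
  rw [gaussMap, gaussBranch, one_div_one_div, Int.fract_eq_iff]
  exact ⟨hy.1, hy.2, k + 1, by push_cast; ring⟩

theorem iUnion_gaussBranch_image : ⋃ k, gaussBranch k '' Ico 0 1 = Ioc 0 1 := by
  ext x
  simp only [mem_iUnion, mem_image]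
  constructor
  · rintro ⟨k, y, hy, rfl⟩
    have h1 : (1 : ℝ) ≤ k + 1 + y := by linarith [hy.1, (Nat.cast_nonneg k : (0 : ℝ) ≤ k)]
    exact ⟨by unfold gaussBranch; positivity, (div_le_one (by linarith)).2 h1⟩
  · intro hx
    have h1 : 1 ≤ 1 / x := (one_le_div hx.1).2 hx.2
    have h2 : 1 ≤ ⌊1 / x⌋₊ := (Nat.one_le_floor_iff _).2 h1
    refine ⟨⌊1 / x⌋₊ - 1, 1 / x - ⌊1 / x⌋₊, ⟨?_, ?_⟩, ?_⟩
    · linarith [Nat.floor_le (zero_le_one.trans h1)]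
    · linarith [Nat.lt_floor_add_one (1 / x)]
    · rw [gaussBranch, Nat.cast_sub h2, Nat.cast_one, sub_add_cancel, add_sub_cancel,
        one_div_one_div]

theorem measurable_gaussBranch (k : ℕ) : Measurable (gaussBranch k) := by
  unfold gaussBranch
  fun_prop

theorem condMeasure_apply (s : ℝ) {B : Set ℝ} (hB : MeasurableSet B) :
    condMeasure s B =
      ∫⁻ x in Ico 0 1, B.indicator (fun x => ENNReal.ofReal ((1 + s) / (1 + s * x) ^ 2)) x := by
  rw [condMeasure, withDensity_apply _ hB, lintegral_indicator hB]

/-- Decomposition along the first partial quotient: given that it is `k + 1`, the image under the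
Gauss map of a point of law `condMeasure s` has law `condMeasure (1 / (k + 1 + s))`. -/
theorem condMeasure_eq_tsum {s : ℝ} (hs : 0 ≤ s) {B : Set ℝ} (hB : MeasurableSet B) :
    condMeasure s B =
      ∑' k : ℕ, condWeight s k * condMeasure (1 / (k + 1 + s)) (gaussBranch k ⁻¹' B) := by
  have hpos : ∀ (k : ℕ) (y : ℝ), y ∈ Ico (0 : ℝ) 1 → 0 < (k : ℝ) + 1 + y := fun k y hy => by
    linarith [hy.1, (Nat.cast_nonneg k : (0 : ℝ) ≤ k)]
  have hinj : ∀ k : ℕ, InjOn (gaussBranch k) (Ico 0 1) := fun k y hy z hz h => by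
    rw [← gaussMap_gaussBranch k hy, h, gaussMap_gaussBranch k hz]
  have hdisj : Pairwise (Function.onFun Disjoint fun k => gaussBranch k '' Ico 0 1) := by
    intro j k hjk
    refine Set.disjoint_left.2 ?_
    rintro _ ⟨y, hy, rfl⟩ ⟨z, hz, h⟩
    have := floor_one_div_gaussBranch j hy
    rw [← h, floor_one_div_gaussBranch k hz] at this
    omega
  have hmeas : ∀ k : ℕ, MeasurableSet (gaussBranch k '' Ico 0 1) := fun k =>
    measurableSet_Ico.image_of_measurable_injOn (measurable_gaussBranch k) (hinj k)
  -- The branches map `[0, 1)` onto disjoint intervals that tile `(0, 1]`, not `[0, 1)`.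
  rw [condMeasure_apply s hB, Measure.restrict_congr_set Ico_ae_eq_Ioc, ← iUnion_gaussBranch_image,
    lintegral_iUnion hmeas hdisj]
  refine tsum_congr fun k => ?_
  have hk : (0 : ℝ) < k + 1 + s := by positivity
  have hderiv : ∀ y ∈ Ico (0 : ℝ) 1,
      HasDerivWithinAt (gaussBranch k) (-1 / (k + 1 + y) ^ 2) (Ico 0 1) y := by
    intro y hy
    have h : HasDerivAt (fun y : ℝ => (k : ℝ) + 1 + y) 1 y := (hasDerivAt_id y).const_add _
    have := h.inv (hpos k y hy).ne'
    unfold gaussBranch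
    simp only [one_div]
    exact this.hasDerivWithinAt
  rw [lintegral_image_eq_lintegral_abs_deriv_mul measurableSet_Ico hderiv (hinj k),
    condMeasure_apply _ (measurable_gaussBranch k hB),
    ← lintegral_const_mul' (condWeight s k) _ ENNReal.ofReal_ne_top]
  refine setLIntegral_congr_fun measurableSet_Ico fun y hy => ?_
  have hky := hpos k y hy
  have hy0 := hy.1
  by_cases hyB : gaussBranch k y ∈ B
  · have hyB' : y ∈ gaussBranch k ⁻¹' B := hyB
    simp only [indicator_of_mem hyB, indicator_of_mem hyB']
    rw [condWeight, ← ENNReal.ofReal_mul (by positivity), ← ENNReal.ofReal_mul (by positivity),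
      abs_div, abs_neg, abs_one, abs_of_nonneg (by positivity), gaussBranch]
    congr 1
    field_simp
    ring
  · have hyB' : y ∉ gaussBranch k ⁻¹' B := hyB
    simp only [indicator_of_notMem hyB, indicator_of_notMem hyB', mul_zero]

/-- The density `(1 + s) / (1 + s x) ^ 2` has primitive `(1 + s) x / (1 + s x)`. -/
theorem condMeasure_univ {s : ℝ} (hs : 0 ≤ s) : condMeasure s univ = 1 := by
  have hpos : ∀ x ∈ Icc (0 : ℝ) 1, 0 < 1 + s * x := fun x hx => by
    have := mul_nonneg hs hx.1
    linarith
  have hcont : ContinuousOn (fun x : ℝ => (1 + s) / (1 + s * x) ^ 2) (Icc 0 1) :=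
    ContinuousOn.div (by fun_prop) (by fun_prop) fun x hx => (pow_pos (hpos x hx) 2).ne'
  have hint : ∫ x in (0 : ℝ)..1, (1 + s) / (1 + s * x) ^ 2 = 1 := by
    have hderiv : ∀ x ∈ uIcc (0 : ℝ) 1, HasDerivAt (fun x : ℝ => (1 + s) * x / (1 + s * x))
        ((1 + s) / (1 + s * x) ^ 2) x := by
      intro x hx
      rw [uIcc_of_le zero_le_one] at hx
      have h1 : HasDerivAt (fun x : ℝ => (1 + s) * x) (1 + s) x := by
        simpa using (hasDerivAt_id x).const_mul (1 + s)
      have h2 : HasDerivAt (fun x : ℝ => 1 + s * x) s x := by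
        simpa using ((hasDerivAt_id x).const_mul s).const_add 1
      refine (h1.div h2 (hpos x hx).ne').congr_deriv ?_
      congr 1
      ring
    rw [intervalIntegral.integral_eq_sub_of_hasDerivAt hderiv]
    · have : 1 + s ≠ 0 := by positivity
      simp [this]
    · exact (by rwa [uIcc_of_le zero_le_one] : ContinuousOn _ (uIcc (0 : ℝ) 1)).intervalIntegrable
  rw [condMeasure, withDensity_apply _ MeasurableSet.univ, Measure.restrict_univ,
    Measure.restrict_congr_set Ico_ae_eq_Ioc, ← ofReal_integral_eq_lintegral_ofReal,
    ← intervalIntegral.integral_of_le zero_le_one, hint, ENNReal.ofReal_one]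
  · exact (hcont.integrableOn_Icc).mono_set Ioc_subset_Icc_self
  · exact ae_of_all _ fun x => by positivity

theorem condMeasure_zero : condMeasure 0 = volume.restrict (Ico 0 1) := by
  simp [condMeasure]

theorem tsum_condWeight {s : ℝ} (hs : 0 ≤ s) : ∑' k : ℕ, condWeight s k = 1 := by
  have h := condMeasure_eq_tsum hs MeasurableSet.univ
  rw [condMeasure_univ hs] at h
  rw [h]
  refine tsum_congr fun k => ?_
  rw [preimage_univ, condMeasure_univ (by positivity), mul_one]

theorem condWeight_le {s : ℝ} (hs : s ∈ Icc (0 : ℝ) 1) (k : ℕ) :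
    condWeight s k ≤ 2 * digitWeight k := by
  have h0 := hs.1
  rw [condWeight, digitWeight, ← ENNReal.ofReal_ofNat 2, ← ENNReal.ofReal_mul (by norm_num)]
  refine ENNReal.ofReal_le_ofReal ?_
  rw [mul_one_div]
  refine div_le_div₀ zero_le_two (by linarith [hs.2]) (by positivity) ?_
  exact mul_le_mul (by linarith) (by linarith) (by positivity) (by positivity)

theorem digitWeight_le {s : ℝ} (hs : s ∈ Icc (0 : ℝ) 1) (k : ℕ) :
    digitWeight k ≤ 2 * condWeight s k := by
  have h0 := hs.1
  have h1 := hs.2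
  have hk : (0 : ℝ) ≤ k := Nat.cast_nonneg k
  rw [condWeight, digitWeight, ← ENNReal.ofReal_ofNat 2, ← ENNReal.ofReal_mul (by norm_num)]
  refine ENNReal.ofReal_le_ofReal ?_
  rw [← mul_div_assoc, div_le_div_iff₀ (by positivity) (by positivity), one_mul]
  calc ((k : ℝ) + 1 + s) * (k + 2 + s) ≤ ((1 + s) * (k + 1)) * (2 * (k + 2)) := by
        gcongr
        · nlinarith
        · linarith
    _ = 2 * (1 + s) * ((k + 1) * (k + 2)) := by ring

theorem one_div_mem_Icc {s : ℝ} (hs : 0 ≤ s) (k : ℕ) : 1 / ((k : ℝ) + 1 + s) ∈ Icc (0 : ℝ) 1 :=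
  ⟨by positivity,
    (div_le_one (by positivity)).2 (by linarith [(Nat.cast_nonneg k : (0 : ℝ) ≤ k)])⟩

theorem condMeasure_congr (s : ℝ) {A B : Set ℝ} (h : ∀ x ∈ Ico (0 : ℝ) 1, x ∈ A ↔ x ∈ B) :
    condMeasure s A = condMeasure s B := by
  refine measure_congr ((withDensity_absolutelyContinuous _ _).ae_le ?_)
  filter_upwards [ae_restrict_mem measurableSet_Ico] with x hx
  exact propext (h x hx)

/-- The weighted product `a₁(x) ^ α₁ * a₂(x) ^ α₂ * ⋯` of the first partial quotients of `x` for a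
list `[α₁, α₂, …]` of exponents. -/
noncomputable def digitProd : List ℝ → ℝ → ℝ
  | [], _ => 1
  | α :: l, x => (⌊1 / x⌋₊ : ℝ) ^ α * digitProd l (gaussMap x)

theorem measurable_gaussMap : Measurable gaussMap := by
  unfold gaussMap
  fun_prop

theorem measurable_digitProd (l : List ℝ) : Measurable (digitProd l) := by
  induction l with
  | nil => exact measurable_const
  | cons α l ih =>
    have h1 : Measurable fun x : ℝ => ((⌊1 / x⌋₊ : ℕ) : ℝ) :=
      measurable_from_nat.comp (Nat.measurable_floor.comp (measurable_const.div measurable_id))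
    exact (h1.pow_const α).mul (ih.comp measurable_gaussMap)

theorem digitProd_cons_gaussBranch (α : ℝ) (l : List ℝ) (k : ℕ) {y : ℝ}
    (hy : y ∈ Ico (0 : ℝ) 1) :
    digitProd (α :: l) (gaussBranch k y) = ((k : ℝ) + 1) ^ α * digitProd l y := by
  rw [digitProd, floor_one_div_gaussBranch k hy, gaussMap_gaussBranch k hy]
  push_cast
  rfl

/-- The product in `weightedLimsupSet` is a weighted product of the first partial quotients of
`Tⁿ⁻¹ x`. -/
theorem digitProd_ofFn_iterate {m : ℕ} (t : Fin m → ℝ) {n : ℕ} (hn : 1 ≤ n) (x : ℝ) :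
    ∏ i : Fin m, (partialQuotient (n + i) x : ℝ) ^ t i
      = digitProd (List.ofFn t) (gaussMap^[n - 1] x) := by
  induction m generalizing n with
  | zero => simp [digitProd]
  | succ m ih =>
    rw [Fin.prod_univ_succ, List.ofFn_succ, digitProd, ← Function.iterate_succ_apply' gaussMap]
    have h := ih (fun i => t i.succ) (n := n + 1) (by omega)
    rw [show n + 1 - 1 = (n - 1).succ by omega] at h
    rw [← h]
    congr 1
    refine Finset.prod_congr rfl fun i _ => ?_
    rw [Fin.val_succ, show n + 1 + (i : ℕ) = n + (i + 1) by ring]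

theorem measurableSet_le_digitProd (l : List ℝ) (v : ℝ) :
    MeasurableSet {x | v ≤ digitProd l x} :=
  measurableSet_le measurable_const (measurable_digitProd l)

theorem condMeasure_preimage_le_digitProd (s : ℝ) (α : ℝ) (l : List ℝ) (v : ℝ) (k : ℕ) :
    condMeasure s (gaussBranch k ⁻¹' {x | v ≤ digitProd (α :: l) x})
      = condMeasure s {x | v / ((k : ℝ) + 1) ^ α ≤ digitProd l x} := by
  refine condMeasure_congr s fun y hy => ?_
  simp only [mem_preimage, mem_ofPred_eq]
  rw [digitProd_cons_gaussBranch _ _ _ hy, div_le_iff₀' (by positivity)]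

/-- Partial quotients are comparable to independent digits: each conditional weight is within a
factor `2` of `digitWeight`, whatever came before. -/
theorem condMeasure_le_digitTail (l : List ℝ) {s : ℝ} (hs : s ∈ Icc (0 : ℝ) 1) (v : ℝ) :
    condMeasure s {x | v ≤ digitProd l x} ≤ 2 ^ l.length * digitTail l v := by
  induction l generalizing s v with
  | nil =>
    by_cases h : v ≤ 1 <;> simp [digitProd, digitTail, h, condMeasure_univ hs.1]
  | cons α l ih =>
    rw [condMeasure_eq_tsum hs.1 (measurableSet_le_digitProd _ v), digitTail,
      ← ENNReal.tsum_mul_left]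
    refine ENNReal.tsum_le_tsum fun k => ?_
    rw [condMeasure_preimage_le_digitProd]
    refine (mul_le_mul' (condWeight_le hs k) (ih (one_div_mem_Icc hs.1 k) _)).trans (le_of_eq ?_)
    rw [List.length_cons, pow_succ]
    ring

theorem digitTail_le_condMeasure (l : List ℝ) {s : ℝ} (hs : s ∈ Icc (0 : ℝ) 1) (v : ℝ) :
    digitTail l v ≤ 2 ^ l.length * condMeasure s {x | v ≤ digitProd l x} := by
  induction l generalizing s v with
  | nil =>
    by_cases h : v ≤ 1 <;> simp [digitProd, digitTail, h, condMeasure_univ hs.1]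
  | cons α l ih =>
    rw [condMeasure_eq_tsum hs.1 (measurableSet_le_digitProd _ v), digitTail,
      ← ENNReal.tsum_mul_left]
    refine ENNReal.tsum_le_tsum fun k => ?_
    rw [condMeasure_preimage_le_digitProd]
    refine (mul_le_mul' (digitWeight_le hs k) (ih (one_div_mem_Icc hs.1 k) _)).trans (le_of_eq ?_)
    rw [List.length_cons, pow_succ]
    ring

/-- An event that has probability at most `β` under all laws `condMeasure s` still does after any
number of steps of the Gauss map. -/
theorem condMeasure_preimage_iterate_le {B : Set ℝ} (hB : MeasurableSet B) {β : ℝ≥0∞}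
    (h : ∀ s ∈ Icc (0 : ℝ) 1, condMeasure s B ≤ β) (r : ℕ) {s : ℝ} (hs : s ∈ Icc (0 : ℝ) 1) :
    condMeasure s (gaussMap^[r] ⁻¹' B) ≤ β := by
  induction r generalizing s with
  | zero => exact h s hs
  | succ r ih =>
    rw [condMeasure_eq_tsum hs.1 ((measurable_gaussMap.iterate _) hB)]
    calc _ ≤ ∑' k : ℕ, condWeight s k * β := by
          refine ENNReal.tsum_le_tsum fun k => mul_le_mul_right ?_ _
          refine le_trans (le_of_eq ?_) (ih (one_div_mem_Icc hs.1 k))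
          refine condMeasure_congr _ fun y hy => ?_
          rw [mem_preimage, mem_preimage, Function.iterate_succ_apply, gaussMap_gaussBranch k hy,
            mem_preimage]
      _ = β := by rw [ENNReal.tsum_mul_right, tsum_condWeight hs.1, one_mul]

/-- Whatever the first partial quotients are, an event that has probability at most `β` under all
laws `condMeasure s` still has conditional probability at most `β` after them. -/
theorem condMeasure_inter_preimage_iterate_le {B : Set ℝ} (hB : MeasurableSet B) {β : ℝ≥0∞}
    (h : ∀ s ∈ Icc (0 : ℝ) 1, condMeasure s B ≤ β) (l : List ℝ) (v : ℝ) {s : ℝ}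
    (hs : s ∈ Icc (0 : ℝ) 1) :
    condMeasure s ({x | digitProd l x < v} ∩ gaussMap^[l.length] ⁻¹' B)
      ≤ condMeasure s {x | digitProd l x < v} * β := by
  induction l generalizing s v with
  | nil =>
    by_cases hv : 1 < v <;> simp [digitProd, hv, condMeasure_univ hs.1, h s hs]
  | cons α l ih =>
    have hm : MeasurableSet {x | digitProd (α :: l) x < v} :=
      measurableSet_lt (measurable_digitProd _) measurable_const
    rw [condMeasure_eq_tsum hs.1 (hm.inter ((measurable_gaussMap.iterate _) hB)),
      condMeasure_eq_tsum hs.1 hm, ← ENNReal.tsum_mul_right]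
    refine ENNReal.tsum_le_tsum fun k => ?_
    rw [mul_assoc]
    refine mul_le_mul_right ?_ _
    have hlt : ∀ y ∈ Ico (0 : ℝ) 1, digitProd (α :: l) (gaussBranch k y) < v ↔
        digitProd l y < v / ((k : ℝ) + 1) ^ α := fun y hy => by
      rw [digitProd_cons_gaussBranch _ _ _ hy, lt_div_iff₀' (by positivity)]
    have h1 : condMeasure (1 / (k + 1 + s)) (gaussBranch k ⁻¹'
          ({x | digitProd (α :: l) x < v} ∩ gaussMap^[(α :: l).length] ⁻¹' B))
        = condMeasure (1 / (k + 1 + s))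
          ({x | digitProd l x < v / ((k : ℝ) + 1) ^ α} ∩ gaussMap^[l.length] ⁻¹' B) := by
      refine condMeasure_congr _ fun y hy => ?_
      simp only [mem_preimage, mem_inter_iff, mem_ofPred_eq, List.length_cons,
        Function.iterate_succ_apply, gaussMap_gaussBranch k hy, hlt y hy]
    have h2 : condMeasure (1 / (k + 1 + s)) (gaussBranch k ⁻¹' {x | digitProd (α :: l) x < v})
        = condMeasure (1 / (k + 1 + s)) {x | digitProd l x < v / ((k : ℝ) + 1) ^ α} := by
      refine condMeasure_congr _ fun y hy => ?_
      simp only [mem_preimage, mem_ofPred_eq, hlt y hy]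
    rw [h1, h2]
    exact ih _ (one_div_mem_Icc hs.1 k)

/-! ### The zero-one dichotomy -/

theorem condMeasure_lt_le_exp (l : List ℝ) {s : ℝ} (hs : s ∈ Icc (0 : ℝ) 1) (v : ℝ) :
    condMeasure s {x | digitProd l x < v}
      ≤ ENNReal.ofReal (Real.exp (-((digitTail l v).toReal / 2 ^ l.length))) := by
  have hfin : IsFiniteMeasure (condMeasure s) := ⟨by simp [condMeasure_univ hs.1]⟩
  have hc : {x | digitProd l x < v} = {x | v ≤ digitProd l x}ᶜ := by
    ext x
    simp
  have htop : digitTail l v ≠ ∞ := ne_top_of_le_ne_top ENNReal.one_ne_top (digitTail_le_one l v)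
  have hle : ENNReal.ofReal ((digitTail l v).toReal / 2 ^ l.length)
      ≤ condMeasure s {x | v ≤ digitProd l x} := by
    rw [ENNReal.ofReal_div_of_pos (by positivity), ENNReal.ofReal_toReal htop,
      ENNReal.ofReal_pow zero_le_two, ENNReal.ofReal_ofNat]
    exact ENNReal.div_le_of_le_mul' (digitTail_le_condMeasure l hs v)
  rw [hc, measure_compl (measurableSet_le_digitProd l v) (measure_ne_top _ _),
    condMeasure_univ hs.1]
  refine (tsub_le_tsub_left hle 1).trans ?_
  rw [← ENNReal.ofReal_one, ← ENNReal.ofReal_sub _ (by positivity)]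
  exact ENNReal.ofReal_le_ofReal (by
    have := Real.add_one_le_exp (-((digitTail l v).toReal / 2 ^ l.length))
    linarith)

/-- The set of points for which the weighted products over the first `N` consecutive blocks of
`l.length` partial quotients stay below the thresholds `u 0, …, u (N - 1)`. -/
def lowBlocks (l : List ℝ) (u : ℕ → ℝ) (N : ℕ) : Set ℝ :=
  {x | ∀ i < N, digitProd l (gaussMap^[l.length * i] x) < u i}

theorem measurableSet_lowBlocks (l : List ℝ) (u : ℕ → ℝ) (N : ℕ) :
    MeasurableSet (lowBlocks l u N) := by
  have : lowBlocks l u N =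
      ⋂ i, ⋂ (_ : i < N), {x | digitProd l (gaussMap^[l.length * i] x) < u i} := by
    ext x
    simp [lowBlocks]
  rw [this]
  exact MeasurableSet.iInter fun i => MeasurableSet.iInter fun _ =>
    measurableSet_lt ((measurable_digitProd l).comp (measurable_gaussMap.iterate _))
      measurable_const

theorem lowBlocks_succ (l : List ℝ) (u : ℕ → ℝ) (N : ℕ) :
    lowBlocks l u (N + 1) = {x | digitProd l x < u 0} ∩
      gaussMap^[l.length] ⁻¹' lowBlocks l (fun i => u (i + 1)) N := by
  ext x
  simp only [lowBlocks, mem_inter_iff, mem_ofPred_eq, mem_preimage, ← Function.iterate_add_apply]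
  constructor
  · intro h
    refine ⟨by simpa using h 0 (by omega), fun i hi => ?_⟩
    simpa [mul_add] using h (i + 1) (by omega)
  · rintro ⟨h0, h1⟩ i hi
    rcases i with _ | i
    · simpa using h0
    · simpa [mul_add] using h1 i (by omega)

/-- Successive blocks are treated one at a time: given the earlier ones, each stays low with
conditional probability at most `exp (-p)`, where `p` is comparable to its `digitTail`. -/
theorem condMeasure_lowBlocks_le (l : List ℝ) (u : ℕ → ℝ) (N : ℕ) {s : ℝ}
    (hs : s ∈ Icc (0 : ℝ) 1) :
    condMeasure s (lowBlocks l u N) ≤ ENNReal.ofReal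
      (Real.exp (-((∑ i ∈ Finset.range N, (digitTail l (u i)).toReal) / 2 ^ l.length))) := by
  induction N generalizing u s with
  | zero =>
    refine (measure_mono (subset_univ _)).trans ?_
    simp [condMeasure_univ hs.1]
  | succ N ih =>
    rw [lowBlocks_succ]
    refine (condMeasure_inter_preimage_iterate_le (measurableSet_lowBlocks l _ N)
      (fun s hs => ih (fun i => u (i + 1)) hs) l (u 0) hs).trans ?_
    refine (mul_le_mul_left (condMeasure_lt_le_exp l hs (u 0)) _).trans (le_of_eq ?_)
    rw [← ENNReal.ofReal_mul (Real.exp_nonneg _), ← Real.exp_add, Finset.sum_range_succ']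
    congr 2
    ring

theorem condMeasure_iInter_lowBlocks (l : List ℝ) {u : ℕ → ℝ}
    (hu : ¬ Summable fun i => (digitTail l (u i)).toReal) {s : ℝ} (hs : s ∈ Icc (0 : ℝ) 1) :
    condMeasure s (⋂ N, lowBlocks l u N) = 0 := by
  have hlim : Tendsto (fun N => ENNReal.ofReal (Real.exp
      (-((∑ i ∈ Finset.range N, (digitTail l (u i)).toReal) / 2 ^ l.length)))) atTop (𝓝 0) := by
    rw [← ENNReal.ofReal_zero]
    refine ENNReal.tendsto_ofReal (Real.tendsto_exp_neg_atTop_nhds_zero.comp ?_)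
    exact ((not_summable_iff_tendsto_nat_atTop_of_nonneg
      (fun _ => ENNReal.toReal_nonneg)).1 hu).atTop_div_const (by positivity)
  refine le_antisymm (ge_of_tendsto' hlim fun N => ?_) zero_le
  exact (measure_mono (iInter_subset _ N)).trans (condMeasure_lowBlocks_le l u N hs)

/-- Divergence half of the Borel–Cantelli lemma along the blocks starting at `r + l.length * i`. -/
theorem ae_frequently_blocks (l : List ℝ) {u : ℕ → ℝ}
    (hu : ¬ Summable fun i => (digitTail l (u i)).toReal) (r : ℕ) :
    ∀ᵐ x ∂(condMeasure 0), ∀ j, ∃ i, j ≤ i ∧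
      u i ≤ digitProd l (gaussMap^[l.length * i + r] x) := by
  rw [ae_all_iff]
  intro j
  have hu' : ¬ Summable fun i => (digitTail l (u (i + j))).toReal := fun h =>
    hu ((summable_nat_add_iff j).1 h)
  have h0 := condMeasure_preimage_iterate_le
    (MeasurableSet.iInter fun N => measurableSet_lowBlocks l (fun i => u (i + j)) N)
    (fun s hs => (condMeasure_iInter_lowBlocks l hu' hs).le) (l.length * j + r)
    (left_mem_Icc.2 zero_le_one)
  refine measure_mono_null (fun x hx => ?_) (le_antisymm h0 zero_le)
  simp only [mem_compl_iff, mem_ofPred_eq, not_exists, not_and, not_le] at hx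
  simp only [mem_preimage, mem_iInter, lowBlocks, mem_ofPred_eq]
  intro N i _
  rw [← Function.iterate_add_apply, ← add_assoc, ← mul_add]
  exact hx (i + j) (Nat.le_add_left _ _)

theorem exists_not_summable_residue {m : ℕ} (hm : 1 ≤ m) {f : ℕ → ℝ} (hf0 : 0 ≤ f)
    (hf : ¬ Summable f) :
    ∃ r, ¬ Summable fun i => f (m * i + r) := by
  by_contra! h
  have : NeZero m := ⟨by omega⟩
  refine hf ((Nat.divModEquiv m).symm.summable_iff.1 ?_)
  rw [← (Equiv.prodComm (Fin m) ℕ).summable_iff]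
  refine (summable_prod_of_nonneg fun _ => hf0 _).2 ⟨fun r => ?_, Summable.of_finite⟩
  simpa [mul_comm] using h r

theorem volume_weightedLimsupSet_le_one {m : ℕ} (t : Fin m → ℝ) (Ψ : ℕ → ℝ) :
    volume (weightedLimsupSet t Ψ) ≤ 1 :=
  (measure_mono fun _ hx => hx.1).trans (by simp : volume (Ico (0 : ℝ) 1) ≤ 1)

theorem volume_weightedLimsupSet_of_not_summable {m : ℕ} (hm : 1 ≤ m) (t : Fin m → ℝ) (Ψ : ℕ → ℝ)
    (h : ¬ Summable fun n : ℕ => (digitTail (List.ofFn t) (Ψ (n + 1))).toReal) :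
    volume (weightedLimsupSet t Ψ) = 1 := by
  obtain ⟨r, hr⟩ := exists_not_summable_residue hm (fun _ => ENNReal.toReal_nonneg) h
  have hae := ae_frequently_blocks (List.ofFn t) hr r
  rw [condMeasure_zero, List.length_ofFn] at hae
  refine le_antisymm (volume_weightedLimsupSet_le_one t Ψ) ?_
  have h1 : (volume (Ico (0 : ℝ) 1)) = 1 := by simp
  rw [← h1]
  refine measure_mono_ae ?_
  filter_upwards [(ae_restrict_iff' measurableSet_Ico).1 hae] with x hx hx01
  refine ⟨hx01, Set.infinite_of_not_bddAbove fun ⟨b, hb⟩ => ?_⟩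
  obtain ⟨i, hi, hix⟩ := hx hx01 b
  have hmem := hb (a := m * i + r + 1)
    ⟨by omega, by rw [digitProd_ofFn_iterate t (by omega)]; exact hix⟩
  have : i ≤ m * i := Nat.le_mul_of_pos_left i hm
  omega

theorem volume_weightedLimsupSet_of_summable {m : ℕ} (t : Fin m → ℝ) (Ψ : ℕ → ℝ)
    (h : Summable fun n : ℕ => (digitTail (List.ofFn t) (Ψ (n + 1))).toReal) :
    volume (weightedLimsupSet t Ψ) = 0 := by
  have htop : ∀ n, digitTail (List.ofFn t) (Ψ (n + 1)) ≠ ∞ := fun n =>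
    ne_top_of_le_ne_top ENNReal.one_ne_top (digitTail_le_one _ _)
  set A : ℕ → Set ℝ := fun n =>
    gaussMap^[n] ⁻¹' {x | Ψ (n + 1) ≤ digitProd (List.ofFn t) x} with hA
  have hle : ∀ n, condMeasure 0 (A n) ≤ 2 ^ m * digitTail (List.ofFn t) (Ψ (n + 1)) := fun n =>
    condMeasure_preimage_iterate_le (measurableSet_le_digitProd _ _)
      (fun s hs => by simpa using condMeasure_le_digitTail (List.ofFn t) hs (Ψ (n + 1))) n
      (left_mem_Icc.2 zero_le_one)
  have hsum : ∑' n, condMeasure 0 (A n) ≠ ∞ := by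
    refine ne_top_of_le_ne_top ?_ (ENNReal.tsum_le_tsum hle)
    rw [ENNReal.tsum_mul_left]
    refine ENNReal.mul_ne_top (by simp) ?_
    have := h.tsum_ofReal_ne_top
    simpa [ENNReal.ofReal_toReal (htop _)] using this
  have h0 := measure_setOfPred_frequently_eq_zero (p := fun n x => x ∈ A n) hsum
  rw [condMeasure_zero, Measure.restrict_apply' measurableSet_Ico] at h0
  refine measure_mono_null (fun x hx => mem_inter ?_ hx.1) h0
  rw [mem_ofPred_eq, Nat.frequently_atTop_iff_infinite]
  refine Set.infinite_of_not_bddAbove fun ⟨b, hb⟩ => ?_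
  obtain ⟨n, ⟨hn1, hn⟩, hbn⟩ := hx.2.exists_gt (b + 1)
  have hmem := hb (a := n - 1) (by
    rw [digitProd_ofFn_iterate t hn1] at hn
    simp only [hA, mem_ofPred_eq, mem_preimage]
    rwa [Nat.sub_add_cancel hn1])
  omega

/-! ### Comparison with the series -/

theorem le_maxWeight {m : ℕ} (t : Fin m → ℝ) (i : Fin m) : t i ≤ maxWeight t :=
  le_ciSup (Set.finite_range t).bddAbove i

theorem exists_eq_maxWeight {m : ℕ} (hm : 1 ≤ m) (t : Fin m → ℝ) : ∃ i, t i = maxWeight t := by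
  have : Nonempty (Fin m) := ⟨⟨0, hm⟩⟩
  exact exists_eq_ciSup_of_finite

theorem one_le_maxWeightMult {m : ℕ} (hm : 1 ≤ m) (t : Fin m → ℝ) : 1 ≤ maxWeightMult t := by
  obtain ⟨i, hi⟩ := exists_eq_maxWeight hm t
  exact Finset.card_pos.2 ⟨i, by simp [hi]⟩

theorem count_normalized {m : ℕ} {t : Fin m → ℝ} (hT : 0 < maxWeight t) :
    ((List.ofFn t).map (· / maxWeight t)).count 1 = maxWeightMult t := by
  rw [← Multiset.coe_count, ← Multiset.map_coe, ← Fin.univ_val_map, Multiset.map_map,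
    Multiset.count_map, maxWeightMult, Finset.card_def, Finset.filter_val]
  congr 1
  refine Multiset.filter_congr fun i _ => ?_
  rw [Function.comp_apply, eq_comm, div_eq_one_iff_eq hT.ne']

/-- The two-sided estimate of the tail with all weights, in the normalization of the series. -/
theorem digitTail_ofFn_bounds {m : ℕ} (hm : 1 ≤ m) {t : Fin m → ℝ} (ht : ∀ i, 0 < t i) :
    (∃ C : ℝ, 0 ≤ C ∧ ∀ v : ℝ, 1 ≤ v → (digitTail (List.ofFn t) v).toReal ≤
      C * ((1 + Real.log v / maxWeight t) ^ (maxWeightMult t - 1) / v ^ (1 / maxWeight t))) ∧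
    ∃ c : ℝ, 0 < c ∧ ∀ v : ℝ, 1 ≤ v →
      c * (Real.log v ^ (maxWeightMult t - 1) / v ^ (1 / maxWeight t))
        ≤ (digitTail (List.ofFn t) v).toReal := by
  have hT : 0 < maxWeight t := (ht ⟨0, hm⟩).trans_le (le_maxWeight t _)
  set T := maxWeight t with hTdef
  set e := maxWeightMult t - 1 with he
  have hcount : ((List.ofFn t).map (· / T)).count 1 = e + 1 := by
    rw [count_normalized hT, he, Nat.sub_add_cancel (one_le_maxWeightMult hm t)]
  have hmem : ∀ α ∈ (List.ofFn t).map (· / T), 0 ≤ α ∧ α ≤ 1 := by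
    intro α hα
    obtain ⟨β, hβ, rfl⟩ := List.mem_map.1 hα
    obtain ⟨i, rfl⟩ := (List.mem_ofFn' _ _).1 hβ
    exact ⟨div_nonneg (ht i).le hT.le, (div_le_one hT).2 (le_maxWeight t i)⟩
  have htop : ∀ v, digitTail (List.ofFn t) v ≠ ∞ := fun v =>
    ne_top_of_le_ne_top ENNReal.one_ne_top (digitTail_le_one _ _)
  have hlog : ∀ v : ℝ, 1 ≤ v → Real.log (v ^ (1 / T)) = Real.log v / T := fun v hv => by
    rw [Real.log_rpow (by linarith), one_div_mul_eq_div]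
  obtain ⟨⟨C, hC, hup⟩, c, hc, hlow⟩ := digitTail_bounds hmem hcount
  constructor
  · refine ⟨C, hC, fun v hv => ?_⟩
    have hv0 : 0 < v := by linarith
    have hl : 0 ≤ Real.log v := Real.log_nonneg hv
    refine ENNReal.toReal_le_of_le_ofReal (by positivity) ?_
    rw [← digitTail_map_div hT _ hv0]
    refine (hup _ (by positivity)).trans (le_of_eq ?_)
    have h1 : 1 ≤ v ^ (1 / T) := Real.one_le_rpow hv (by positivity)
    rw [tailOrder, Real.posLog_eq_log (by rwa [abs_of_pos (by positivity)]), hlog v hv]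
  · refine ⟨c / T ^ e, by positivity, fun v hv => ?_⟩
    have hv0 : 0 < v := by linarith
    refine (ENNReal.ofReal_le_iff_le_toReal (htop v)).1 ?_
    rw [← digitTail_map_div hT _ hv0]
    refine le_trans (le_of_eq ?_) (hlow _ (Real.one_le_rpow hv (by positivity)))
    rw [hlog v hv, div_pow]
    congr 1
    field_simp

theorem theorem1p4 (m : ℕ) (hm : 1 ≤ m) (t : Fin m → ℝ) (ht : ∀ i, 0 < t i)
    (Ψ : ℕ → ℝ) (hΨ : ∀ n, 1 ≤ n → 1 ≤ Ψ n) :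
    (MeasureTheory.volume (weightedLimsupSet t Ψ) = 0 ∨
      MeasureTheory.volume (weightedLimsupSet t Ψ) = 1) ∧
    ((maxWeightMult t = 1 ∨ ∃ c : ℝ, 1 < c ∧ ∀ᶠ n in Filter.atTop, c ≤ Ψ n) →
      WeightedSeriesConverges t Ψ → MeasureTheory.volume (weightedLimsupSet t Ψ) = 0) ∧
    (¬ WeightedSeriesConverges t Ψ → MeasureTheory.volume (weightedLimsupSet t Ψ) = 1) := by
  obtain ⟨⟨C, hC, hup⟩, c, hc, hlow⟩ := digitTail_ofFn_bounds hm ht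
  have hT : 0 < maxWeight t := (ht ⟨0, hm⟩).trans_le (le_maxWeight t _)
  have hΨ1 : ∀ n, 1 ≤ Ψ (n + 1) := fun n => hΨ (n + 1) (by omega)
  refine ⟨?_, ?_, ?_⟩
  · by_cases h : Summable fun n : ℕ => (digitTail (List.ofFn t) (Ψ (n + 1))).toReal
    · exact Or.inl (volume_weightedLimsupSet_of_summable t Ψ h)
    · exact Or.inr (volume_weightedLimsupSet_of_not_summable hm t Ψ h)
  · intro hcase hconv
    refine volume_weightedLimsupSet_of_summable t Ψ ?_
    -- When `ℓ = 1` the power of `1 + log Ψ` is trivial; otherwise `log Ψ` is bounded below.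
    obtain ⟨K, hK⟩ : ∃ K : ℝ, ∀ᶠ n : ℕ in atTop,
        (1 + Real.log (Ψ (n + 1)) / maxWeight t) ^ (maxWeightMult t - 1)
          ≤ K * Real.log (Ψ (n + 1)) ^ (maxWeightMult t - 1) := by
      rcases hcase with h1 | ⟨b, hb, hev⟩
      · exact ⟨1, Eventually.of_forall fun n => by simp [h1]⟩
      · have hlb : 0 < Real.log b := Real.log_pos hb
        refine ⟨(1 / Real.log b + 1 / maxWeight t) ^ (maxWeightMult t - 1), ?_⟩
        filter_upwards [(tendsto_add_atTop_nat 1).eventually hev] with n hn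
        have hl : Real.log b ≤ Real.log (Ψ (n + 1)) := Real.log_le_log (by linarith) hn
        have hl0 : 0 < Real.log (Ψ (n + 1)) := hlb.trans_le hl
        rw [← mul_pow]
        refine pow_le_pow_left₀ (by positivity) ?_ _
        rw [add_mul, one_div_mul_eq_div, one_div_mul_eq_div]
        gcongr
        exact (one_le_div hlb).2 hl
    refine Summable.of_norm_bounded_eventually_nat (Summable.mul_left (C * K) hconv) ?_
    filter_upwards [hK] with n hn
    rw [Real.norm_of_nonneg ENNReal.toReal_nonneg, mul_assoc, ← mul_div_assoc K]
    have hpos : 0 < Ψ (n + 1) := zero_lt_one.trans_le (hΨ1 n)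
    refine (hup _ (hΨ1 n)).trans ?_
    gcongr
  · intro hdiv
    refine volume_weightedLimsupSet_of_not_summable hm t Ψ fun h => hdiv ?_
    refine Summable.of_nonneg_of_le (fun n => ?_) (fun n => ?_) (h.mul_left (1 / c))
    · have := Real.log_nonneg (hΨ1 n)
      have : 0 < Ψ (n + 1) := zero_lt_one.trans_le (hΨ1 n)
      positivity
    · rw [one_div_mul_eq_div, le_div_iff₀ hc, mul_comm]
      exact hlow _ (hΨ1 n)
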